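/- Let $k,h_1,h_2,\alpha_1,\alpha_2$ be natural numbers with $h_1,h_2<k$, $1\le\alpha_j\le h_j+1$ for $j=1,2$, and $\alpha_1+\alpha_2=k+1$. Put $W_j=\mathbb C^{h_j+1}$. For a complex $(h_1+h_2+2)\times(k+1)$ matrix $P=\begin{bmatrix}P_1\\P_2\end{bmatrix}$ with blocks $P_j$ of size $(h_j+1)\times(k+1)$, let $\mathcal T^{P}\in\bigwedge^{\alpha_1}W_1\otimes\bigwedge^{\alpha_2}W_2$ be the bifocal Grassmann tensor of profile $(\alpha_1,\alpha_2)$, whose entries are the $(k+1)\times(k+1)$ minors of $P$ formed by $\alpha_1$ rows of $P_1$ and $\alpha_2$ rows of $P_2$. These are the Plücker coordinates of type $(\alpha_1,\alpha_2)$ of the column space of $P$ in $W_1\oplus W_2$. Let $$\mathcal X=\mathcal X^{(k,h_1,h_2)}_{(\alpha_1,\alpha_2)}\subset\mathbb P\Bigl(\bigwedge^{\alpha_1}W_1\otimes\bigwedge^{\alpha_2}W_2\Bigr)$$ be the Zariski closure of the set of points $[\mathcal T^{P}]$ with $\operatorname{rank}P=k+1$ and $\mathcal T^{P}\neq0$,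 that is, of the image of the Grassmannian of $(k+1)$-dimensional subspaces of $W_1\oplus W_2$ under the linear projection $\mathbb P(\bigwedge^{k+1}(W_1\oplus W_2))\dashrightarrow\mathbb P(\bigwedge^{\alpha_1}W_1\otimes\bigwedge^{\alpha_2}W_2)$. Then $\mathcal X$ is an irreducible projective variety, and it is birational to a homogeneous space with respect to the action of $G=GL(h_1+1,\mathbb C)\times GL(h_2+1,\mathbb C)$. More precisely, there are an irreducible quasi-projective variety $Y$ over $\mathbb C$ with a transitive algebraic action of $G$, and an isomorphism from a dense open subset $U$ of $\mathcal X$ onto a dense open subset of $Y$, such that $U$ is stable under the natural action $(A,B)\mapsto\bigwedge^{\alpha_1}A\otimes\bigwedge^{\alpha_2}B$ of $G$ on tensors and the isomorphism is $G$-equivariant. -/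

import Mathlib

open scoped LinearAlgebra.Projectivization MatrixGroups

noncomputable section

/-! ### Classical quasi-projective varieties over `ℂ` -/

/-- The complex projective space with homogeneous coordinates indexed by `ι`. -/
def ProjSpace (ι : Type) : Type := ℙ ℂ (ι → ℂ)

namespace ProjSpace

/-- The point with homogeneous coordinates `v`. -/
def mk {ι : Type} (v : ι → ℂ) (hv : v ≠ 0) : ProjSpace ι := Projectivization.mk ℂ v hv

/-- A choice of homogeneous coordinates. It is only used for conditions on homogeneous polynomials
that do not depend on the choice. -/
def rep {ι : Type} (x : ProjSpace ι) : ι → ℂ := Projectivization.rep x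

/-- The Zariski topology: the complements of the hypersurfaces `F = 0`, with `F` homogeneous, form
a basis of open sets. -/
instance zariskiTopology (ι : Type) : TopologicalSpace (ProjSpace ι) :=
  TopologicalSpace.generateFrom
    {U | ∃ (F : MvPolynomial ι ℂ) (d : ℕ), F.IsHomogeneous d ∧
      U = {x : ProjSpace ι | MvPolynomial.eval x.rep F ≠ 0}}

end ProjSpace

/-- A quasi-projective variety: an irreducible locally closed subset of a projective space. -/
def IsQuasiProjectiveVariety {ι : Type} (X : Set (ProjSpace ι)) : Prop :=
  IsLocallyClosed X ∧ IsIrreducible X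

/-- `f` is a regular map on the set `U`: near each point of `U` it is given by homogeneous
polynomials of the same degree without common zero. (The neighbourhood of the point is the set
where the polynomials do not all vanish; a smaller basic neighbourhood `H ≠ 0` is obtained by
multiplying all of them by `H`.) -/
def IsRegularMapOn {ι κ : Type} (f : ProjSpace ι → ProjSpace κ) (U : Set (ProjSpace ι)) : Prop :=
  ∀ x ∈ U, ∃ (d : ℕ) (F : κ → MvPolynomial ι ℂ),
    (∀ j, (F j).IsHomogeneous d) ∧
    (fun j => MvPolynomial.eval x.rep (F j)) ≠ 0 ∧
    ∀ y ∈ U, ∀ hy : (fun j => MvPolynomial.eval y.rep (F j)) ≠ 0,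
      f y = ProjSpace.mk (fun j => MvPolynomial.eval y.rep (F j)) hy

/-- A birational map between `X` and `Y`: an isomorphism, with inverse, from a dense open subset
of `X` onto a dense open subset of `Y`. The values of `toFun` outside `source` and of `invFun`
outside `target` are irrelevant. -/
structure BirationalMap {ι κ : Type} (X : Set (ProjSpace ι)) (Y : Set (ProjSpace κ)) where
  source : Set (ProjSpace ι)
  target : Set (ProjSpace κ)
  source_open : ∃ O : Set (ProjSpace ι), IsOpen O ∧ source = X ∩ O
  target_open : ∃ O : Set (ProjSpace κ), IsOpen O ∧ target = Y ∩ O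
  source_dense : X ⊆ closure source
  target_dense : Y ⊆ closure target
  toFun : ProjSpace ι → ProjSpace κ
  invFun : ProjSpace κ → ProjSpace ι
  mapsTo : Set.MapsTo toFun source target
  mapsTo_inv : Set.MapsTo invFun target source
  invOn : Set.InvOn invFun toFun source target
  regular : IsRegularMapOn toFun source
  regular_inv : IsRegularMapOn invFun target

/-- The image of a point of the domain of definition, as a point of `Y`. -/
def BirationalMap.apply {ι κ : Type} {X : Set (ProjSpace ι)} {Y : Set (ProjSpace κ)}
    (φ : BirationalMap X Y) (x : ProjSpace ι) (hx : x ∈ φ.source) : Y :=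
  ⟨φ.toFun x, by
    obtain ⟨O, -, hO⟩ := φ.target_open
    have h := φ.mapsTo hx
    rw [hO] at h
    exact h.1⟩

/-! ### Homogeneous spaces for `GL(m) × GL(n)` -/

/-- The group `GL(m, ℂ) × GL(n, ℂ)`. -/
abbrev GLPair (m n : ℕ) : Type := GL (Fin m) ℂ × GL (Fin n) ℂ

/-- The entries of the two matrices of a pair, as affine coordinates on `GL(m) × GL(n)`. -/
def GLPair.entries {m n : ℕ} (g : GLPair m n) : (Fin m × Fin m) ⊕ (Fin n × Fin n) → ℂ :=
  Sum.elim (fun p => (g.1 : Matrix (Fin m) (Fin m) ℂ) p.1 p.2)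
    (fun p => (g.2 : Matrix (Fin n) (Fin n) ℂ) p.1 p.2)

/-- Polynomials in the homogeneous coordinates of a projective space whose coefficients are
polynomials in the entries of a pair of matrices. -/
abbrev ActionPoly (m n : ℕ) (κ : Type) : Type :=
  MvPolynomial κ (MvPolynomial ((Fin m × Fin m) ⊕ (Fin n × Fin n)) ℂ)

/-- The value at the pair `g` and the coordinate vector `v`. -/
def ActionPoly.value {m n : ℕ} {κ : Type} (F : ActionPoly m n κ) (g : GLPair m n) (v : κ → ℂ) :
    ℂ :=
  MvPolynomial.eval₂ (MvPolynomial.eval g.entries) v F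

/-- The action map `(GL(m) × GL(n)) × Y → Y` is a morphism of varieties: near each point it is
given by polynomials in the matrix entries and in the homogeneous coordinates, homogeneous of the
same degree in the latter and without common zero. (Regular functions on `GL(m) × GL(n)` may have
powers of the determinants in the denominator; these can be cleared in homogeneous coordinates.) -/
def IsRegularAction {m n : ℕ} {κ : Type} (Y : Set (ProjSpace κ)) [MulAction (GLPair m n) Y] :
    Prop :=
  ∀ (g₀ : GLPair m n) (y₀ : Y), ∃ (d : ℕ) (F : κ → ActionPoly m n κ),
    (∀ j, (F j).IsHomogeneous d) ∧
    (fun j => (F j).value g₀ y₀.1.rep) ≠ 0 ∧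
    ∀ (g : GLPair m n) (y : Y) (h : (fun j => (F j).value g y.1.rep) ≠ 0),
      (g • y : Y).1 = ProjSpace.mk (fun j => (F j).value g y.1.rep) h

/-- A homogeneous space for `GL(m) × GL(n)`: a variety with a transitive algebraic action of this
group. (Every homogeneous space of a linear algebraic group is quasi-projective.) -/
structure HomogeneousSpace (m n : ℕ) where
  /-- the index set of the homogeneous coordinates of the ambient projective space -/
  Index : Type
  finite_index : Finite Index
  carrier : Set (ProjSpace Index)
  isVariety : IsQuasiProjectiveVariety carrier
  action : MulAction (GLPair m n) carrier
  transitive : MulAction.IsPretransitive (GLPair m n) carrier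
  regular : IsRegularAction (m := m) (n := n) carrier

attribute [instance] HomogeneousSpace.action

/-! ### Bifocal Grassmann tensors -/

/-- Index set of the standard basis of `⋀^α₁ ℂ^(h₁+1) ⊗ ⋀^α₂ ℂ^(h₂+1)`: pairs consisting of an
increasing sequence of `α₁` rows of the first camera and one of `α₂` rows of the second. -/
abbrev BifocalIndex (h₁ h₂ α₁ α₂ : ℕ) : Type :=
  (Fin α₁ ↪o Fin (h₁ + 1)) × (Fin α₂ ↪o Fin (h₂ + 1))

/-- The stacked matrix `P = [P₁ ; P₂]` of two cameras from `ℙ^k` to `ℙ^h₁` and to `ℙ^h₂`. -/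
abbrev CameraPair (k h₁ h₂ : ℕ) : Type :=
  Matrix (Fin (h₁ + 1) ⊕ Fin (h₂ + 1)) (Fin (k + 1)) ℂ

/-- The Plücker coordinate of the column space of `P` at the rows `r 0, …, r k`. -/
def pluckerCoord {k h₁ h₂ : ℕ} (P : CameraPair k h₁ h₂)
    (r : Fin (k + 1) → Fin (h₁ + 1) ⊕ Fin (h₂ + 1)) : ℂ :=
  (P.submatrix r id).det

/-- The `k + 1` rows of `P` picked by an index: first the `α₁` rows in the block `P₁`, then the
`α₂` rows in the block `P₂`. -/
def bifocalRows {k h₁ h₂ α₁ α₂ : ℕ} (hα : α₁ + α₂ = k + 1) (st : BifocalIndex h₁ h₂ α₁ α₂) :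
    Fin (k + 1) → Fin (h₁ + 1) ⊕ Fin (h₂ + 1) :=
  fun i => Sum.map st.1 st.2 (finSumFinEquiv.symm (Fin.cast hα.symm i))

/-- The bifocal Grassmann tensor of profile `(α₁, α₂)`: the maximal minors of `P` with `α₁` rows
in `P₁` and `α₂` rows in `P₂`. -/
def bifocalTensor {k h₁ h₂ α₁ α₂ : ℕ} (hα : α₁ + α₂ = k + 1) (P : CameraPair k h₁ h₂) :
    BifocalIndex h₁ h₂ α₁ α₂ → ℂ :=
  fun st => pluckerCoord P (bifocalRows hα st)

/-- The image of the Grassmannian of `(k+1)`-dimensional subspaces `L` of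
`ℂ^(h₁+1) ⊕ ℂ^(h₂+1)` under the linear projection `ℙ(⋀^(k+1)) ⇢ ℙ(⋀^α₁ ⊗ ⋀^α₂)`. A subspace `L`
outside the centre of the projection is sent to the point whose coordinates are its Plücker
coordinates of type `(α₁, α₂)`, computed from any matrix whose columns span `L`. -/
def bifocalTensorImage {k : ℕ} (h₁ h₂ : ℕ) {α₁ α₂ : ℕ} (hα : α₁ + α₂ = k + 1) :
    Set (ProjSpace (BifocalIndex h₁ h₂ α₁ α₂)) :=
  {x | ∃ L : Submodule ℂ (Fin (h₁ + 1) ⊕ Fin (h₂ + 1) → ℂ), Module.finrank ℂ L = k + 1 ∧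
    ∃ P : CameraPair k h₁ h₂, Submodule.span ℂ (Set.range P.col) = L ∧
      ∃ hP : bifocalTensor hα P ≠ 0, x = ProjSpace.mk (bifocalTensor hα P) hP}

/-- The variety of bifocal Grassmann tensors: the Zariski closure of that image. -/
def bifocalVariety {k : ℕ} (h₁ h₂ : ℕ) {α₁ α₂ : ℕ} (hα : α₁ + α₂ = k + 1) :
    Set (ProjSpace (BifocalIndex h₁ h₂ α₁ α₂)) :=
  closure (bifocalTensorImage h₁ h₂ hα)

/-- The action `⋀^α₁ A ⊗ ⋀^α₂ B` of a pair `(A, B)` in `GL(h₁+1) × GL(h₂+1)` on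
`⋀^α₁ ℂ^(h₁+1) ⊗ ⋀^α₂ ℂ^(h₂+1)`, in coordinates. -/
def tensorAct {h₁ h₂ α₁ α₂ : ℕ} (g : GLPair (h₁ + 1) (h₂ + 1))
    (T : BifocalIndex h₁ h₂ α₁ α₂ → ℂ) : BifocalIndex h₁ h₂ α₁ α₂ → ℂ :=
  fun st => ∑ st' : BifocalIndex h₁ h₂ α₁ α₂,
    ((g.1 : Matrix (Fin (h₁ + 1)) (Fin (h₁ + 1)) ℂ).submatrix st.1 st'.1).det *
      ((g.2 : Matrix (Fin (h₂ + 1)) (Fin (h₂ + 1)) ℂ).submatrix st.2 st'.2).det * T st'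

/-- A birational map from a set of bifocal tensors to a homogeneous space is equivariant: its
domain is stable under the natural action of `GL(h₁+1) × GL(h₂+1)` on tensors, which it carries
to the action on the homogeneous space. -/
def BirationalMap.IsEquivariant {h₁ h₂ α₁ α₂ : ℕ}
    {X : Set (ProjSpace (BifocalIndex h₁ h₂ α₁ α₂))} {Y : HomogeneousSpace (h₁ + 1) (h₂ + 1)}
    (φ : BirationalMap X Y.carrier) : Prop :=
  ∀ (g : GLPair (h₁ + 1) (h₂ + 1)) (T : BifocalIndex h₁ h₂ α₁ α₂ → ℂ) (hT : T ≠ 0)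
    (hx : ProjSpace.mk T hT ∈ φ.source),
    ∃ (hgT : tensorAct g T ≠ 0) (hgx : ProjSpace.mk (tensorAct g T) hgT ∈ φ.source),
      φ.apply (ProjSpace.mk (tensorAct g T) hgT) hgx = g • φ.apply (ProjSpace.mk T hT) hx

end

/-!
The variety of bifocal tensors is the closure of a single orbit of `GL(h₁+1) × GL(h₂+1)`, so that
the orbit itself is the homogeneous space and the birational map is the identity of the orbit.

A general subspace `L ⊆ W₁ ⊕ W₂` of dimension `k + 1` is the column space of a matrix `P` whose two
blocks have independent rows; their row spaces `R₁` and `R₂` together span `ℂ^(k+1)`. Pairs of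
subspaces with given dimensions that span the space are all equivalent under `GL(k+1)`
(`Submodule.exists_adapted_basis`), and a change of basis of `R₁` and of `R₂` is the action of a
pair `(A, B)` on the rows of `P`. So `P = diag(A, B) P₀ Q` for the pair `P₀` of coordinate
projections (`exists_eq_fromBlocks_mul_standardCameraPair_mul`), and by the Cauchy–Binet formula the
tensor of `P` is a multiple of `(⋀^α₁ A ⊗ ⋀^α₂ B) T₀`, with `T₀` the tensor of `P₀`
(`bifocalTensor_fromBlocks_mul`, `bifocalTensor_mul_right`). A polynomial that does not vanish at
some bifocal tensor does not vanish at a general one, which lies on the orbit of `T₀`, up to a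
scalar: the orbit is dense (`bifocalVariety_eq_closure_tensorOrbit`).

The orbit is irreducible as an image of `GL × GL`. It is open in its closure by the usual argument:
Chevalley's theorem (`MvPolynomial.exists_principalOpen_subset_image`, deduced from the theorem for
prime spectra by the Nullstellensatz) gives a nonempty open subset of the closure inside the orbit,
and its translates cover the orbit (`exists_isOpen_tensorOrbit_eq`). The passage from affine to
projective space uses that the orbit of the vector `T₀` is a cone, because a scalar matrix `s` in
the second factor acts as `s^α₂` and `ℂ` has roots of order `α₂ ≥ 1`.
-/

noncomputable section

/-! ### Homogeneous polynomials and the Zariski topology -/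

theorem MvPolynomial.IsHomogeneous.eval_smul {ι R : Type*} [CommSemiring R]
    {F : MvPolynomial ι R} {d : ℕ} (hF : F.IsHomogeneous d) (t : R) (v : ι → R) :
    MvPolynomial.eval (t • v) F = t ^ d * MvPolynomial.eval v F := by
  simp only [MvPolynomial.eval_eq, Finset.mul_sum]
  refine Finset.sum_congr rfl fun s hs => ?_
  have hdeg : ∑ i ∈ s.support, s i = d := (hF.degree_eq_sum_deg_support hs).symm
  simp only [Pi.smul_apply, smul_eq_mul, mul_pow, Finset.prod_mul_distrib,
    Finset.prod_pow_eq_pow_sum, hdeg]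
  ring

/-- Along the line through `v`, the homogeneous components of `F` are the coefficients of the
polynomial function `t ↦ F (t v)`; they vanish when that function does for all `t ≠ 0`. -/
theorem MvPolynomial.eval_homogeneousComponent_eq_zero {ι K : Type*} [Field K] [Infinite K]
    {F : MvPolynomial ι K} {v : ι → K}
    (h : ∀ t : K, t ≠ 0 → MvPolynomial.eval (t • v) F = 0) (d : ℕ) :
    MvPolynomial.eval v (MvPolynomial.homogeneousComponent d F) = 0 := by
  let p : Polynomial K := ∑ i ∈ Finset.range (F.totalDegree + 1),
    Polynomial.monomial i (MvPolynomial.eval v (MvPolynomial.homogeneousComponent i F))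
  have hp : ∀ t, p.eval t = MvPolynomial.eval (t • v) F := fun t => by
    conv_rhs => rw [← MvPolynomial.sum_homogeneousComponent F, map_sum]
    rw [Polynomial.eval_finsetSum]
    refine Finset.sum_congr rfl fun i _ => ?_
    rw [Polynomial.eval_monomial,
      (MvPolynomial.homogeneousComponent_isHomogeneous i F).eval_smul, mul_comm]
  have hp0 : p = 0 := by
    refine Polynomial.eq_zero_of_infinite_isRoot _ ((Set.infinite_of_finite_compl
      (s := {t : K | t ≠ 0}) ?_).mono fun t ht => ?_)
    · simp [Set.compl_ofPred]
    · exact (hp t).trans (h t ht)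
  by_cases hd : d < F.totalDegree + 1
  · have := congrArg (fun q => Polynomial.coeff q d) hp0
    simpa [p, Polynomial.finsetSum_coeff, Polynomial.coeff_monomial, hd] using this
  · rw [MvPolynomial.homogeneousComponent_eq_zero d F (by omega), map_zero]

namespace ProjSpace

variable {ι : Type}

theorem rep_ne_zero (x : ProjSpace ι) : x.rep ≠ 0 := Projectivization.rep_nonzero x

theorem mk_rep (x : ProjSpace ι) : mk x.rep x.rep_ne_zero = x := Projectivization.mk_rep x

theorem exists_rep_mk (v : ι → ℂ) (hv : v ≠ 0) : ∃ c : ℂ, c ≠ 0 ∧ (mk v hv).rep = c • v := by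
  obtain ⟨a, ha⟩ := Projectivization.exists_smul_eq_mk_rep ℂ v hv
  exact ⟨a, a.ne_zero, ha.symm⟩

theorem mk_smul {v : ι → ℂ} (hv : v ≠ 0) {c : ℂ} {w : ι → ℂ} (hw : w ≠ 0) (h : w = c • v) :
    mk w hw = mk v hv :=
  (Projectivization.mk_eq_mk_iff' ℂ w v hw hv).2 ⟨c, h.symm⟩

theorem eval_rep_mk_ne_zero {F : MvPolynomial ι ℂ} {d : ℕ} (hF : F.IsHomogeneous d)
    (v : ι → ℂ) (hv : v ≠ 0) :
    MvPolynomial.eval (mk v hv).rep F ≠ 0 ↔ MvPolynomial.eval v F ≠ 0 := by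
  obtain ⟨c, hc, h⟩ := exists_rep_mk v hv
  rw [h, hF.eval_smul]
  simp [hc]

theorem isTopologicalBasis_basicOpen (ι : Type) : TopologicalSpace.IsTopologicalBasis
    {U : Set (ProjSpace ι) | ∃ (F : MvPolynomial ι ℂ) (d : ℕ), F.IsHomogeneous d ∧
      U = {x : ProjSpace ι | MvPolynomial.eval x.rep F ≠ 0}} where
  exists_subset_inter := by
    rintro _ ⟨F, d, hF, rfl⟩ _ ⟨G, e, hG, rfl⟩ x hx
    refine ⟨_, ⟨F * G, d + e, hF.mul hG, rfl⟩, ?_, ?_⟩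
    · simpa using hx
    · intro y hy
      simpa using hy
  sUnion_eq := Set.eq_univ_of_forall fun x =>
    ⟨_, ⟨1, 0, MvPolynomial.isHomogeneous_one _ _, rfl⟩, by simp⟩
  eq_generateFrom := rfl

theorem isOpen_basicOpen {F : MvPolynomial ι ℂ} {d : ℕ} (hF : F.IsHomogeneous d) :
    IsOpen {x : ProjSpace ι | MvPolynomial.eval x.rep F ≠ 0} :=
  (isTopologicalBasis_basicOpen ι).isOpen ⟨F, d, hF, rfl⟩

theorem mem_closure_iff {S : Set (ProjSpace ι)} {x : ProjSpace ι} :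
    x ∈ closure S ↔ ∀ (F : MvPolynomial ι ℂ) (d : ℕ), F.IsHomogeneous d →
      MvPolynomial.eval x.rep F ≠ 0 → ∃ y ∈ S, MvPolynomial.eval y.rep F ≠ 0 := by
  rw [(isTopologicalBasis_basicOpen ι).mem_closure_iff]
  constructor
  · intro h F d hF hx
    obtain ⟨y, hy, hyS⟩ := h _ ⟨F, d, hF, rfl⟩ hx
    exact ⟨y, hyS, hy⟩
  · rintro h _ ⟨F, d, hF, rfl⟩ hx
    obtain ⟨y, hyS, hy⟩ := h F d hF hx
    exact ⟨y, hy, hyS⟩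

theorem isPreirreducible_iff {S : Set (ProjSpace ι)} :
    IsPreirreducible S ↔ ∀ (F G : MvPolynomial ι ℂ) (d e : ℕ), F.IsHomogeneous d →
      G.IsHomogeneous e → (∃ x ∈ S, MvPolynomial.eval x.rep F ≠ 0) →
      (∃ x ∈ S, MvPolynomial.eval x.rep G ≠ 0) →
      ∃ x ∈ S, MvPolynomial.eval x.rep F ≠ 0 ∧ MvPolynomial.eval x.rep G ≠ 0 := by
  constructor
  · intro h F G d e hF hG hFS hGS
    exact h _ _ (isOpen_basicOpen hF) (isOpen_basicOpen hG) hFS hGS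
  · rintro h U V hU hV ⟨x, hxS, hxU⟩ ⟨y, hyS, hyV⟩
    obtain ⟨_, ⟨F, d, hF, rfl⟩, hxF, hFU⟩ :=
      (isTopologicalBasis_basicOpen ι).exists_subset_of_mem_open hxU hU
    obtain ⟨_, ⟨G, e, hG, rfl⟩, hyG, hGV⟩ :=
      (isTopologicalBasis_basicOpen ι).exists_subset_of_mem_open hyV hV
    obtain ⟨z, hzS, hzF, hzG⟩ := h F G d e hF hG ⟨x, hxS, hxF⟩ ⟨y, hyS, hyG⟩
    exact ⟨z, hzS, hFU hzF, hGV hzG⟩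

/-- The identity is a regular map, given by the coordinates themselves. -/
theorem isRegularMapOn_id (U : Set (ProjSpace ι)) : IsRegularMapOn id U := by
  intro x _
  refine ⟨1, MvPolynomial.X, fun j => MvPolynomial.isHomogeneous_X _ _, ?_, ?_⟩
  · simpa using x.rep_ne_zero
  · intro y _ hy
    refine (mk_rep y).symm.trans ?_
    congr 1
    simp

end ProjSpace

/-! ### Images of polynomial maps -/

theorem MvPolynomial.eval_aeval {E ι R : Type*} [CommSemiring R] (p : ι → MvPolynomial E R)
    (F : MvPolynomial ι R) (e : E → R) :
    eval e (aeval p F) = eval (fun i => eval e (p i)) F := by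
  induction F using MvPolynomial.induction_on with
  | C r => simp
  | add F G hF hG => rw [map_add, map_add, hF, hG, map_add]
  | mul_X F i hF => rw [map_mul, map_mul, hF, map_mul, aeval_X, eval_X]

theorem MvPolynomial.exists_eval_ne_zero {E R : Type*} [CommRing R] [IsDomain R] [Infinite R]
    {F : MvPolynomial E R} (hF : F ≠ 0) : ∃ e, eval e F ≠ 0 := by
  by_contra! h
  exact hF (MvPolynomial.funext fun e => by simpa using h e)

/-- Chevalley's theorem for the points of affine space: the image of the principal open set `b ≠ 0`
under the polynomial map `p` contains a nonempty principal open subset of its Zariski closure. -/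
theorem MvPolynomial.exists_principalOpen_subset_image {E ι K : Type*} [Finite E] [Finite ι]
    [Field K] [IsAlgClosed K] (p : ι → MvPolynomial E K) {b : MvPolynomial E K} (hb : b ≠ 0) :
    ∃ a : MvPolynomial ι K, aeval p a ≠ 0 ∧
      ∀ v : ι → K, (∀ F : MvPolynomial ι K, aeval p F = 0 → eval v F = 0) → eval v a ≠ 0 →
        ∃ e : E → K, eval e b ≠ 0 ∧ v = fun i => eval e (p i) := by
  set ρ : MvPolynomial ι K →+* MvPolynomial E K := (aeval p : _ →ₐ[K] _).toRingHom with hρ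
  have hfin : ρ.FinitePresentation := by
    apply RingHom.FinitePresentation.of_finiteType.1
    refine RingHom.FiniteType.of_comp_finiteType (f := (C : K →+* MvPolynomial ι K)) ?_
    have : ρ.comp C = (C : K →+* MvPolynomial E K) := by
      ext x; simp [hρ]
    rw [this]
    exact (RingHom.finiteType_algebraMap (A := K) (B := MvPolynomial E K)).2 inferInstance
  obtain ⟨S, hS⟩ := PrimeSpectrum.exists_constructibleSetData_iff.2
    (PrimeSpectrum.isConstructible_comap_image hfin
      (PrimeSpectrum.isConstructible_basicOpen (f := b)))
  -- The generic point of the closure lies in one of the locally closed pieces `V(g) \ V(f)` of the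
  -- image, so that `g` vanishes on the closure and `f` does not.
  have hη : PrimeSpectrum.comap ρ ⊥ ∈ S.toSet := by
    rw [hS]
    exact ⟨⊥, by simpa using hb, rfl⟩
  simp only [PrimeSpectrum.ConstructibleSetData.toSet, Set.mem_iUnion] at hη
  obtain ⟨D, hDS, hDg, hDf⟩ := hη
  have hg : ∀ i, aeval p (D.g i) = 0 := fun i => by
    have := hDg ⟨i, rfl⟩
    simpa [hρ] using this
  refine ⟨D.f, by simpa [hρ] using hDf, fun v hv hva => ?_⟩
  have hmem : pointToPoint (k := K) v ∈ S.toSet := by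
    simp only [PrimeSpectrum.ConstructibleSetData.toSet, Set.mem_iUnion]
    refine ⟨D, hDS, ?_, ?_⟩
    · rintro _ ⟨i, rfl⟩
      exact (mem_vanishingIdeal_singleton_iff v _).2 (by simpa using hv _ (hg i))
    · intro h
      have := h (Set.mem_singleton D.f)
      exact hva (by simpa using (mem_vanishingIdeal_singleton_iff v _).1 this)
  -- The fibre over the maximal ideal of `v` contains a prime ideal `q` without `b`; by the
  -- Nullstellensatz `b` does not vanish on all of the zero locus of `q`.
  rw [hS] at hmem
  obtain ⟨q, hqb, hq⟩ := hmem
  have hqb' : b ∉ q.asIdeal := hqb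
  rw [← IsPrime.vanishingIdeal_zeroLocus (K := K) q.asIdeal] at hqb'
  simp only [mem_vanishingIdeal_iff, not_forall] at hqb'
  obtain ⟨e, he, heb⟩ := hqb'
  refine ⟨e, by simpa using heb, _root_.funext fun i => ?_⟩
  have h1 : X i - C (v i) ∈ (PrimeSpectrum.comap ρ q).asIdeal := by
    rw [hq]
    exact (mem_vanishingIdeal_singleton_iff v _).2 (by simp)
  have h2 := (mem_zeroLocus_iff.1 he) _ h1
  have h3 : eval e (p i) - v i = 0 := by simpa [hρ] using h2
  exact (sub_eq_zero.1 h3).symm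

/-- If the image of the set `b ≠ 0` under the polynomial map `p` is a cone, then it contains the
nonempty trace, on its Zariski closure, of a principal open set defined by a *homogeneous*
polynomial, and the closure may be described by homogeneous polynomials as well. -/
theorem MvPolynomial.exists_homogeneous_principalOpen_subset_cone {E ι K : Type*} [Finite E]
    [Finite ι] [Field K] [IsAlgClosed K] (p : ι → MvPolynomial E K) {b : MvPolynomial E K}
    (hb : b ≠ 0) {O : Set (ι → K)}
    (hO : ∀ v, v ∈ O ↔ ∃ e : E → K, eval e b ≠ 0 ∧ v = fun i => eval e (p i))
    (hcone : ∀ v ∈ O, ∀ t : K, t ≠ 0 → t • v ∈ O) :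
    ∃ (a : MvPolynomial ι K) (d : ℕ), a.IsHomogeneous d ∧ (∃ v ∈ O, eval v a ≠ 0) ∧
      ∀ v : ι → K, (∀ (F : MvPolynomial ι K) (n : ℕ), F.IsHomogeneous n →
        (∀ w ∈ O, eval w F = 0) → eval v F = 0) → eval v a ≠ 0 → v ∈ O := by
  obtain ⟨a, ha, hsub⟩ := exists_principalOpen_subset_image p hb
  have hab : aeval p a * b ≠ 0 := mul_ne_zero ha hb
  obtain ⟨e, he⟩ := exists_eval_ne_zero hab
  rw [map_mul] at he
  obtain ⟨hea, heb⟩ := mul_ne_zero_iff.1 he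
  rw [eval_aeval] at hea
  set v₀ : ι → K := fun i => eval e (p i)
  have hv₀ : v₀ ∈ O := (hO _).2 ⟨e, heb, rfl⟩
  obtain ⟨d, hd⟩ : ∃ d, eval v₀ (homogeneousComponent d a) ≠ 0 := by
    by_contra! h
    apply hea
    rw [← sum_homogeneousComponent a, map_sum]
    exact Finset.sum_eq_zero fun i _ => h i
  refine ⟨_, d, homogeneousComponent_isHomogeneous d a, ⟨v₀, hv₀, hd⟩, fun v hv hva => ?_⟩
  obtain ⟨t, ht, hta⟩ : ∃ t : K, t ≠ 0 ∧ eval (t • v) a ≠ 0 := by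
    by_contra! h
    exact hva (eval_homogeneousComponent_eq_zero h d)
  -- `v` may be moved along its line, out of the zeros of the other components of `a`; the closure
  -- is a cone too, since the components of a polynomial that vanishes on the cone `O` vanish on it.
  have htv : t • v ∈ O := by
    rw [hO]
    refine hsub _ (fun F hF => ?_) hta
    rw [← sum_homogeneousComponent F, map_sum]
    refine Finset.sum_eq_zero fun i _ => ?_
    rw [(homogeneousComponent_isHomogeneous i F).eval_smul,
      hv _ i (homogeneousComponent_isHomogeneous i F) fun w hw => ?_, mul_zero]
    refine eval_homogeneousComponent_eq_zero (fun s hs => ?_) i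
    obtain ⟨e', -, he'⟩ := (hO _).1 (hcone w hw s hs)
    rw [he', ← eval_aeval, hF, map_zero]
  have := hcone _ htv t⁻¹ (inv_ne_zero ht)
  rwa [smul_smul, inv_mul_cancel₀ ht, one_smul] at this

/-! ### The Cauchy–Binet formula and the action on tensors -/

/-- Expansion of an alternating map along a basis: the coefficients are the minors of the matrix of
coordinates. -/
theorem AlternatingMap.apply_eq_sum_det_coord {R M N I : Type*} [CommRing R] [AddCommGroup M]
    [Module R M] [AddCommGroup N] [Module R N] [LinearOrder I] [Fintype I] {n : ℕ}
    (f : M [⋀^Fin n]→ₗ[R] N) (b : Module.Basis I R M) (v : Fin n → M) :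
    f v = ∑ s : Fin n ↪o I, (Matrix.of fun i j => b.coord (s j) (v i)).det • f (b ∘ s) := by
  rw [← exteriorPower.alternatingMapLinearEquiv_apply_ιMulti f v]
  conv_lhs => rw [← (b.exteriorPower n).sum_repr (exteriorPower.ιMulti R n v)]
  rw [map_sum, ← Set.powersetCard.ofFinEmbEquiv.sum_comp]
  refine Finset.sum_congr rfl fun s _ => ?_
  rw [map_smul, exteriorPower.basis_repr_apply, exteriorPower.ιMultiDual_apply_ιMulti,
    exteriorPower.basis_apply, exteriorPower.ιMulti_family,
    exteriorPower.alternatingMapLinearEquiv_apply_ιMulti, Equiv.symm_apply_apply]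

/-- Expansion of an alternating map at the linear combinations of a family `w` whose coefficients
are the rows of a matrix. -/
theorem AlternatingMap.apply_sum_smul {R M N I : Type*} [CommRing R] [AddCommGroup M]
    [Module R M] [AddCommGroup N] [Module R N] [LinearOrder I] [Fintype I] {n : ℕ}
    (f : M [⋀^Fin n]→ₗ[R] N) (A : Matrix (Fin n) I R) (w : I → M) :
    f (fun i => ∑ j, A i j • w j) =
      ∑ s : Fin n ↪o I, (A.submatrix id s).det • f (w ∘ s) := by
  have h := (f.compLinearMap (Fintype.linearCombination R w)).apply_eq_sum_det_coord
    (Pi.basisFun R I) A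
  refine h.trans (Finset.sum_congr rfl fun s _ => ?_)
  congr 1
  rw [AlternatingMap.compLinearMap_apply]
  congr 1
  funext i
  simp [Fintype.linearCombination_apply, Pi.single_apply]

/-- The **Cauchy–Binet formula**. -/
theorem Matrix.det_submatrix_mul {R I J L : Type*} [CommRing R] [LinearOrder I] [Fintype I] {n : ℕ}
    (A : Matrix J I R) (B : Matrix I L R) (r : Fin n → J) (c : Fin n → L) :
    ((A * B).submatrix r c).det =
      ∑ s : Fin n ↪o I, (A.submatrix r s).det * (B.submatrix s c).det := by
  have h := (Matrix.detRowAlternating (R := R) (n := Fin n)).apply_sum_smul (A.submatrix r id)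
    (B.submatrix id c)
  refine Eq.trans ?_ h
  change Matrix.det _ = Matrix.det _
  congr 1
  ext i j
  simp [Matrix.mul_apply, Finset.sum_apply]

section TensorAct

variable {k h₁ h₂ α₁ α₂ : ℕ}

theorem Matrix.det_one_submatrix {R I : Type*} [CommRing R] [LinearOrder I] [Fintype I] {n : ℕ}
    (s t : Fin n ↪o I) :
    ((1 : Matrix I I R).submatrix s t).det = if s = t then 1 else 0 := by
  classical
  split_ifs with h
  · subst h
    rw [Matrix.submatrix_one s s.injective, Matrix.det_one]
  · obtain ⟨i, hi⟩ : ∃ i, s i ∉ Set.range t := by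
      by_contra! h'
      have hst : Set.range s ⊆ Set.range t := Set.range_subset_iff.2 h'
      have hle : (Set.range t).ncard ≤ (Set.range s).ncard := by
        rw [Set.ncard_range_of_injective s.injective, Set.ncard_range_of_injective t.injective]
      exact h (DFunLike.coe_injective ((s.strictMono.range_inj t.strictMono).1
        (Set.eq_of_subset_of_ncard_le hst hle)))
    exact Matrix.det_eq_zero_of_row_eq_zero i fun j =>
      Matrix.one_apply_ne fun hij => hi ⟨j, hij.symm⟩

theorem tensorAct_one (T : BifocalIndex h₁ h₂ α₁ α₂ → ℂ) : tensorAct 1 T = T := by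
  funext st
  simp only [tensorAct, Prod.fst_one, Prod.snd_one, Units.val_one, Matrix.det_one_submatrix]
  rw [Finset.sum_eq_single st]
  · simp
  · intro st' _ hne
    by_cases h1 : st.1 = st'.1
    · have : st.2 ≠ st'.2 := fun h2 => hne (Prod.ext h1 h2).symm
      simp [this]
    · simp [h1]
  · simp

theorem tensorAct_mul (g g' : GLPair (h₁ + 1) (h₂ + 1)) (T : BifocalIndex h₁ h₂ α₁ α₂ → ℂ) :
    tensorAct (g * g') T = tensorAct g (tensorAct g' T) := by
  funext st
  simp only [tensorAct, Prod.fst_mul, Prod.snd_mul, Units.val_mul, Matrix.det_submatrix_mul]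
  rw [Finset.sum_congr rfl fun _ _ => Finset.mul_sum _ _ _, Finset.sum_comm]
  refine Finset.sum_congr rfl fun st' _ => ?_
  rw [Finset.sum_mul_sum, ← Fintype.sum_prod_type', Finset.sum_mul]
  exact Finset.sum_congr rfl fun _ _ => by ring

theorem tensorAct_smul (g : GLPair (h₁ + 1) (h₂ + 1)) (c : ℂ)
    (T : BifocalIndex h₁ h₂ α₁ α₂ → ℂ) : tensorAct g (c • T) = c • tensorAct g T := by
  funext st
  simp only [tensorAct, Pi.smul_apply, smul_eq_mul, Finset.mul_sum]
  exact Finset.sum_congr rfl fun _ _ => by ring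

theorem tensorAct_ne_zero (g : GLPair (h₁ + 1) (h₂ + 1)) {T : BifocalIndex h₁ h₂ α₁ α₂ → ℂ}
    (hT : T ≠ 0) : tensorAct g T ≠ 0 := by
  intro h
  apply hT
  rw [← tensorAct_one T, ← inv_mul_cancel g, tensorAct_mul, h]
  simpa using tensorAct_smul g⁻¹ 0 (0 : BifocalIndex h₁ h₂ α₁ α₂ → ℂ)

/-- The determinant of a family of rows indexed by a disjoint union, as an alternating map of the
rows of the first part. -/
def Matrix.detRowAlternatingInl {m n R : Type*} [Fintype m] [Fintype n] [DecidableEq m]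
    [DecidableEq n] [CommRing R] (v : n → m ⊕ n → R) : (m ⊕ n → R) [⋀^m]→ₗ[R] R where
  toFun u := Matrix.detRowAlternating (Sum.elim u v)
  map_update_add' u i x y := by
    classical
    simp only [← Sum.update_elim_inl]
    convert AlternatingMap.map_update_add _ _ _ _ _
  map_update_smul' u i c x := by
    classical
    simp only [← Sum.update_elim_inl]
    convert AlternatingMap.map_update_smul _ _ _ _ _
  map_eq_zero_of_eq' u i j h hij :=
    AlternatingMap.map_eq_zero_of_eq _ _ (i := Sum.inl i) (j := Sum.inl j) h
      (fun h' => hij (Sum.inl_injective h'))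

/-- The determinant of a family of rows indexed by a disjoint union, as an alternating map of the
rows of the second part. -/
def Matrix.detRowAlternatingInr {m n R : Type*} [Fintype m] [Fintype n] [DecidableEq m]
    [DecidableEq n] [CommRing R] (u : m → m ⊕ n → R) : (m ⊕ n → R) [⋀^n]→ₗ[R] R where
  toFun v := Matrix.detRowAlternating (Sum.elim u v)
  map_update_add' v i x y := by
    classical
    simp only [← Sum.update_elim_inr]
    convert AlternatingMap.map_update_add _ _ _ _ _
  map_update_smul' v i c x := by
    classical
    simp only [← Sum.update_elim_inr]
    convert AlternatingMap.map_update_smul _ _ _ _ _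
  map_eq_zero_of_eq' v i j h hij :=
    AlternatingMap.map_eq_zero_of_eq _ _ (i := Sum.inr i) (j := Sum.inr j) h
      (fun h' => hij (Sum.inr_injective h'))

/-- The bifocal tensor as the determinant of a family of rows indexed by `Fin α₁ ⊕ Fin α₂`. -/
theorem bifocalTensor_eq_det (hα : α₁ + α₂ = k + 1) (P : CameraPair k h₁ h₂)
    (st : BifocalIndex h₁ h₂ α₁ α₂) :
    bifocalTensor hα P st = Matrix.detRowAlternating (Sum.elim
      (fun i j => P (Sum.inl (st.1 i)) (Fin.cast hα (finSumFinEquiv j)))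
      (fun i j => P (Sum.inr (st.2 i)) (Fin.cast hα (finSumFinEquiv j)))) := by
  rw [bifocalTensor, pluckerCoord,
    ← Matrix.det_submatrix_equiv_self (finSumFinEquiv.trans (finCongr hα))]
  change _ = Matrix.det _
  congr 1
  ext i j
  rcases i with i | i <;> simp [bifocalRows]

/-- The tensor of `P` transforms under `⋀^α₁ A ⊗ ⋀^α₂ B` when `A` and `B` act on the rows of the two
blocks of `P`. -/
theorem bifocalTensor_fromBlocks_mul (hα : α₁ + α₂ = k + 1) (g : GLPair (h₁ + 1) (h₂ + 1))
    (P : CameraPair k h₁ h₂) :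
    bifocalTensor hα (Matrix.fromBlocks (g.1 : Matrix (Fin (h₁ + 1)) (Fin (h₁ + 1)) ℂ) 0 0
      (g.2 : Matrix (Fin (h₂ + 1)) (Fin (h₂ + 1)) ℂ) * P) =
      tensorAct g (bifocalTensor hα P) := by
  funext st
  set e : Fin α₁ ⊕ Fin α₂ → Fin (k + 1) := fun j => Fin.cast hα (finSumFinEquiv j)
  set A : Matrix (Fin (h₁ + 1)) (Fin (h₁ + 1)) ℂ := g.1.val
  set B : Matrix (Fin (h₂ + 1)) (Fin (h₂ + 1)) ℂ := g.2.val
  let p : Fin (h₁ + 1) → Fin α₁ ⊕ Fin α₂ → ℂ := fun i j => P (Sum.inl i) (e j)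
  let q : Fin (h₂ + 1) → Fin α₁ ⊕ Fin α₂ → ℂ := fun i j => P (Sum.inr i) (e j)
  have hL : ∀ v, Matrix.detRowAlternating (Sum.elim (fun i => ∑ j, A (st.1 i) j • p j) v) =
      ∑ s : Fin α₁ ↪o Fin (h₁ + 1), (A.submatrix st.1 s).det •
        Matrix.detRowAlternating (Sum.elim (p ∘ s) v) := fun v =>
    (Matrix.detRowAlternatingInl v).apply_sum_smul (A.submatrix st.1 id) p
  have hR : ∀ u, Matrix.detRowAlternating (Sum.elim u (fun i => ∑ j, B (st.2 i) j • q j)) =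
      ∑ t : Fin α₂ ↪o Fin (h₂ + 1), (B.submatrix st.2 t).det •
        Matrix.detRowAlternating (Sum.elim u (q ∘ t)) := fun u =>
    (Matrix.detRowAlternatingInr u).apply_sum_smul (B.submatrix st.2 id) q
  rw [bifocalTensor_eq_det, tensorAct, Fintype.sum_prod_type]
  have h1 : (fun i j => (Matrix.fromBlocks A 0 0 B * P) (Sum.inl (st.1 i)) (e j)) =
      fun i => ∑ j, A (st.1 i) j • p j := by
    funext i j
    simp [Matrix.mul_apply, p, Finset.sum_apply]
  have h2 : (fun i j => (Matrix.fromBlocks A 0 0 B * P) (Sum.inr (st.2 i)) (e j)) =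
      fun i => ∑ j, B (st.2 i) j • q j := by
    funext i j
    simp [Matrix.mul_apply, q, Finset.sum_apply]
  rw [h1, h2, hL]
  refine Finset.sum_congr rfl fun s _ => ?_
  rw [hR, Finset.smul_sum]
  refine Finset.sum_congr rfl fun t _ => ?_
  rw [smul_smul, smul_eq_mul, bifocalTensor_eq_det]
  rfl

theorem bifocalTensor_mul_right (hα : α₁ + α₂ = k + 1) (P : CameraPair k h₁ h₂)
    (Q : Matrix (Fin (k + 1)) (Fin (k + 1)) ℂ) :
    bifocalTensor hα (P * Q) = Q.det • (bifocalTensor hα P : BifocalIndex h₁ h₂ α₁ α₂ → ℂ) := by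
  funext st
  rw [bifocalTensor, pluckerCoord, Pi.smul_apply, smul_eq_mul, mul_comm, bifocalTensor,
    pluckerCoord, ← Matrix.det_mul]
  rfl

end TensorAct

/-! ### Normal form of a pair of subspaces -/

theorem Submodule.exists_span_range_eq {K V : Type*} [Field K] [AddCommGroup V] [Module K V]
    [FiniteDimensional K V] (S : Submodule K V) {I : Type*} [Fintype I]
    (h : Module.finrank K S = Fintype.card I) :
    ∃ f : I → V, Submodule.span K (Set.range f) = S := by
  let b := (Module.finBasisOfFinrankEq K S h).reindex (Fintype.equivFin I).symm
  refine ⟨fun i => b i, ?_⟩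
  have := congrArg (Submodule.map S.subtype) b.span_eq
  rw [Submodule.map_span, ← Set.range_comp, Submodule.map_top, Submodule.range_subtype] at this
  exact this

theorem Submodule.exists_sup_eq_finrank_add {K V : Type*} [Field K] [AddCommGroup V] [Module K V]
    [FiniteDimensional K V] {A R : Submodule K V} (h : A ≤ R) :
    ∃ S : Submodule K V, S ⊔ A = R ∧ Module.finrank K S + Module.finrank K A =
      Module.finrank K R := by
  obtain ⟨C, hC⟩ := A.exists_isCompl
  have hsup : R ⊓ C ⊔ A = R := by
    rw [inf_sup_assoc_of_le C h, sup_comm C A, hC.sup_eq_top, inf_top_eq]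
  have hinf : R ⊓ C ⊓ A = ⊥ := by
    rw [inf_assoc, inf_comm C A, hC.inf_eq_bot, inf_bot_eq]
  refine ⟨R ⊓ C, hsup, ?_⟩
  rw [← Submodule.finrank_sup_add_finrank_inf_eq, hsup, hinf, finrank_bot, add_zero]

/-- Two subspaces that together span the space are coordinate subspaces for a common basis: given
index sets `c₁` and `c₂` that cover `I`, of the sizes of their dimensions, there is a basis such
that the vectors with index in `cᵢ` span `Rᵢ`. -/
theorem Submodule.exists_adapted_basis {K V I : Type*} [Field K] [AddCommGroup V] [Module K V]
    [FiniteDimensional K V] [Fintype I] (hI : Fintype.card I = Module.finrank K V)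
    (R₁ R₂ : Submodule K V) (hR : R₁ ⊔ R₂ = ⊤) (c₁ c₂ : Set I) (hc : c₁ ∪ c₂ = Set.univ)
    (h₁ : Module.finrank K R₁ = c₁.ncard) (h₂ : Module.finrank K R₂ = c₂.ncard) :
    ∃ N : I → V, LinearIndependent K N ∧ Submodule.span K (N '' c₁) = R₁ ∧
      Submodule.span K (N '' c₂) = R₂ := by
  classical
  have hsum := Submodule.finrank_sup_add_finrank_inf_eq R₁ R₂
  rw [hR, finrank_top, h₁, h₂] at hsum
  have hcard := Set.ncard_union_add_ncard_inter c₁ c₂ (Set.toFinite _) (Set.toFinite _)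
  rw [hc, Set.ncard_univ, Nat.card_eq_fintype_card] at hcard
  have hinf : Module.finrank K (R₁ ⊓ R₂ : Submodule K V) = (c₁ ∩ c₂).ncard := by omega
  -- Bases of the intersection and of complements of it in `R₁` and in `R₂` are put together.
  obtain ⟨S₁, hS₁, hS₁'⟩ : ∃ S : Submodule K V, S ⊔ (R₁ ⊓ R₂) = R₁ ∧
      Module.finrank K S = (c₁ \ c₂).ncard := by
    obtain ⟨S, hS, hS'⟩ := Submodule.exists_sup_eq_finrank_add (inf_le_left : R₁ ⊓ R₂ ≤ R₁)
    have := Set.ncard_inter_add_ncard_sdiff_eq_ncard c₁ c₂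
    exact ⟨S, hS, by omega⟩
  obtain ⟨S₂, hS₂, hS₂'⟩ : ∃ S : Submodule K V, S ⊔ (R₁ ⊓ R₂) = R₂ ∧
      Module.finrank K S = (c₂ \ c₁).ncard := by
    obtain ⟨S, hS, hS'⟩ := Submodule.exists_sup_eq_finrank_add (inf_le_right : R₁ ⊓ R₂ ≤ R₂)
    have := Set.ncard_inter_add_ncard_sdiff_eq_ncard c₂ c₁
    rw [Set.inter_comm] at this
    exact ⟨S, hS, by omega⟩
  obtain ⟨f, hf⟩ := (R₁ ⊓ R₂).exists_span_range_eq (I := ↥(c₁ ∩ c₂))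
    (by rw [hinf, Set.ncard_eq_toFinset_card', Set.toFinset_card])
  obtain ⟨f₁, hf₁⟩ := S₁.exists_span_range_eq (I := ↥(c₁ \ c₂))
    (by rw [hS₁', Set.ncard_eq_toFinset_card', Set.toFinset_card])
  obtain ⟨f₂, hf₂⟩ := S₂.exists_span_range_eq (I := ↥(c₂ \ c₁))
    (by rw [hS₂', Set.ncard_eq_toFinset_card', Set.toFinset_card])
  let N : I → V := fun i => if h : i ∈ c₁ ∩ c₂ then f ⟨i, h⟩ else
    if h : i ∈ c₁ \ c₂ then f₁ ⟨i, h⟩ else if h : i ∈ c₂ \ c₁ then f₂ ⟨i, h⟩ else 0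
  have hN : N '' (c₁ ∩ c₂) = Set.range f := by
    rw [Set.image_eq_range]
    congr 1
    funext i
    simp only [N, dif_pos i.2]
  have hN₁ : N '' (c₁ \ c₂) = Set.range f₁ := by
    rw [Set.image_eq_range]
    congr 1
    funext i
    simp only [N, dif_pos i.2, dif_neg (fun h => i.2.2 h.2 : ¬ (i : I) ∈ c₁ ∩ c₂)]
  have hN₂ : N '' (c₂ \ c₁) = Set.range f₂ := by
    rw [Set.image_eq_range]
    congr 1
    funext i
    simp only [N, dif_pos i.2, dif_neg (fun h => i.2.2 h.1 : ¬ (i : I) ∈ c₁ ∩ c₂),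
      dif_neg (fun h => i.2.2 h.1 : ¬ (i : I) ∈ c₁ \ c₂)]
  have hs₁ : Submodule.span K (N '' c₁) = R₁ := by
    rw [← Set.sdiff_union_inter c₁ c₂, Set.image_union, Submodule.span_union, hN₁, hN, hf₁, hf, hS₁]
  have hs₂ : Submodule.span K (N '' c₂) = R₂ := by
    rw [← Set.sdiff_union_inter c₂ c₁, Set.image_union, Submodule.span_union, hN₂,
      Set.inter_comm, hN, hf₂, hf, hS₂]
  refine ⟨N, ?_, hs₁, hs₂⟩
  refine linearIndependent_of_top_le_span_of_card_eq_finrank ?_ hI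
  rw [← Set.image_univ, ← hc, Set.image_union, Submodule.span_union, hs₁, hs₂, hR]

/-- A matrix with independent rows in the span of the rows of `N` is the product of an invertible
matrix with `N`, if both have equally many rows. -/
theorem Matrix.exists_GL_mul_eq {K L I : Type*} [Field K] [Fintype L] [Fintype I]
    [DecidableEq I] {M N : Matrix I L K}
    (hM : LinearIndependent K M.row) (h : ∀ i, M i ∈ Submodule.span K (Set.range N.row)) :
    ∃ A : GL I K, (A : Matrix I I K) * N = M := by
  have h' : ∀ i, ∃ a : I → K, ∑ j, a j • N j = M i := fun i =>
    (Submodule.mem_span_range_iff_exists_fun K).1 (h i)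
  choose A hA using h'
  have hAN : (Matrix.of A) * N = M := by
    ext i j
    rw [← hA i]
    simp [Matrix.mul_apply, Finset.sum_apply]
  have hu : IsUnit (Matrix.of A) := by
    rw [← Matrix.linearIndependent_rows_iff_isUnit, ← Matrix.vecMul_injective_iff]
    rw [← Matrix.vecMul_injective_iff, ← hAN] at hM
    intro x y hxy
    apply hM
    have hxy' : Matrix.vecMul x (Matrix.of A) = Matrix.vecMul y (Matrix.of A) := hxy
    show Matrix.vecMul x _ = Matrix.vecMul y _
    rw [← Matrix.vecMul_vecMul, hxy', Matrix.vecMul_vecMul]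
  exact ⟨hu.unit, hAN⟩

section NormalForm

variable {k h₁ h₂ : ℕ}

/-- The pair of coordinate projections onto the first `h₁ + 1` and onto the last `h₂ + 1`
coordinates of `ℂ^(k+1)`. Row `i` of the second block is the basis vector with index `i + (k - h₂)`,
where `h₂ ≤ k` is understood. -/
def standardCameraPair (k h₁ h₂ : ℕ) : CameraPair k h₁ h₂ :=
  Matrix.of (Sum.elim (fun i j => if (i : ℕ) = j then 1 else 0)
    (fun i j => if (i : ℕ) + (k - h₂) = j then 1 else 0))

/-- A pair of cameras such that each camera has maximal rank and so has the stacked matrix is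
standard, up to coordinate changes. -/
theorem exists_eq_fromBlocks_mul_standardCameraPair_mul (hh₁ : h₁ ≤ k) (hh₂ : h₂ ≤ k)
    (hk : k ≤ h₁ + h₂ + 1) (P : CameraPair k h₁ h₂)
    (hP₁ : LinearIndependent ℂ fun i => P (Sum.inl i))
    (hP₂ : LinearIndependent ℂ fun i => P (Sum.inr i))
    (hP : Submodule.span ℂ (Set.range P.row) = ⊤) :
    ∃ (g : GLPair (h₁ + 1) (h₂ + 1)) (Q : GL (Fin (k + 1)) ℂ),
      P = Matrix.fromBlocks (g.1 : Matrix (Fin (h₁ + 1)) (Fin (h₁ + 1)) ℂ) 0 0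
        (g.2 : Matrix (Fin (h₂ + 1)) (Fin (h₂ + 1)) ℂ) *
          (standardCameraPair k h₁ h₂ * (Q : Matrix (Fin (k + 1)) (Fin (k + 1)) ℂ)) := by
  let e₁ : Fin (h₁ + 1) → Fin (k + 1) := fun i => ⟨i, by omega⟩
  let e₂ : Fin (h₂ + 1) → Fin (k + 1) := fun i => ⟨i + (k - h₂), by omega⟩
  have he₁ : Function.Injective e₁ := fun i j hij => by
    have := congrArg Fin.val hij
    exact Fin.ext this
  have he₂ : Function.Injective e₂ := fun i j hij => by
    have : (i : ℕ) + (k - h₂) = j + (k - h₂) := congrArg Fin.val hij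
    exact Fin.ext (by omega)
  obtain ⟨N, hN, hN₁, hN₂⟩ := Submodule.exists_adapted_basis (K := ℂ) (I := Fin (k + 1))
    (V := Fin (k + 1) → ℂ) (by simp)
    (Submodule.span ℂ (Set.range fun i => P (Sum.inl i)))
    (Submodule.span ℂ (Set.range fun i => P (Sum.inr i)))
    (by
      rw [← Submodule.span_union, ← hP]
      congr 1
      exact (Sum.range_eq P.row).symm)
    (Set.range e₁) (Set.range e₂)
    (Set.eq_univ_of_forall fun i => by
      by_cases hi : (i : ℕ) < h₁ + 1
      · exact Or.inl ⟨⟨i, hi⟩, rfl⟩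
      · exact Or.inr ⟨⟨i - (k - h₂), by omega⟩, Fin.ext (by simp [e₂]; omega)⟩)
    (by rw [finrank_span_eq_card hP₁, Set.ncard_range_of_injective he₁, Nat.card_eq_fintype_card])
    (by rw [finrank_span_eq_card hP₂, Set.ncard_range_of_injective he₂, Nat.card_eq_fintype_card])
  rw [← Set.range_comp] at hN₁ hN₂
  obtain ⟨A, hA⟩ := Matrix.exists_GL_mul_eq (M := Matrix.of fun i => P (Sum.inl i))
    (N := Matrix.of (N ∘ e₁)) hP₁ (fun i => hN₁.symm ▸ Submodule.subset_span ⟨i, rfl⟩)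
  obtain ⟨B, hB⟩ := Matrix.exists_GL_mul_eq (M := Matrix.of fun i => P (Sum.inr i))
    (N := Matrix.of (N ∘ e₂)) hP₂ (fun i => hN₂.symm ▸ Submodule.subset_span ⟨i, rfl⟩)
  have hu : IsUnit (Matrix.of N) := Matrix.linearIndependent_rows_iff_isUnit.1 hN
  refine ⟨(A, B), hu.unit, ?_⟩
  have hstd : standardCameraPair k h₁ h₂ * Matrix.of N =
      Matrix.of (Sum.elim (N ∘ e₁) (N ∘ e₂)) := by
    ext i j
    rw [Matrix.mul_apply]
    rcases i with i | i
    · rw [Finset.sum_eq_single (e₁ i)]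
      · simp [standardCameraPair, e₁]
      · intro l _ hl
        have : (i : ℕ) ≠ l := fun h => hl (Fin.ext h.symm)
        simp [standardCameraPair, this]
      · simp
    · rw [Finset.sum_eq_single (e₂ i)]
      · simp [standardCameraPair, e₂]
      · intro l _ hl
        have : (i : ℕ) + (k - h₂) ≠ l := fun h => hl (Fin.ext h.symm)
        simp [standardCameraPair, this]
      · simp
  rw [IsUnit.unit_spec, hstd]
  ext i j
  rcases i with i | i
  · have := congrFun (congrFun hA i) j
    simpa [Matrix.mul_apply] using this.symm
  · have := congrFun (congrFun hB i) j
    simpa [Matrix.mul_apply] using this.symm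

end NormalForm

/-! ### The action in coordinates -/

section ActionPolynomials

variable {k h₁ h₂ α₁ α₂ : ℕ}

/-- The coordinates of `(⋀^α₁ A ⊗ ⋀^α₂ B) T`, as polynomials in the coordinates of `T` whose
coefficients are polynomials in the entries of `A` and `B`. -/
def tensorActPoly (st : BifocalIndex h₁ h₂ α₁ α₂) :
    ActionPoly (h₁ + 1) (h₂ + 1) (BifocalIndex h₁ h₂ α₁ α₂) :=
  ∑ st' : BifocalIndex h₁ h₂ α₁ α₂, MvPolynomial.C
    (((Matrix.of fun i j => MvPolynomial.X (Sum.inl (i, j))).submatrix st.1 st'.1).det *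
      ((Matrix.of fun i j => MvPolynomial.X (Sum.inr (i, j))).submatrix st.2 st'.2).det) *
    MvPolynomial.X st'

theorem isHomogeneous_tensorActPoly (st : BifocalIndex h₁ h₂ α₁ α₂) :
    (tensorActPoly st).IsHomogeneous 1 :=
  MvPolynomial.IsHomogeneous.sum _ _ _ fun _ _ => MvPolynomial.isHomogeneous_C_mul_X _ _

theorem value_tensorActPoly (st : BifocalIndex h₁ h₂ α₁ α₂) (g : GLPair (h₁ + 1) (h₂ + 1))
    (v : BifocalIndex h₁ h₂ α₁ α₂ → ℂ) : (tensorActPoly st).value g v = tensorAct g v st := by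
  simp only [ActionPoly.value, tensorActPoly, MvPolynomial.eval₂_sum, MvPolynomial.eval₂_mul,
    MvPolynomial.eval₂_C, MvPolynomial.eval₂_X, tensorAct]
  refine Finset.sum_congr rfl fun st' _ => ?_
  rw [map_mul, RingHom.map_det, RingHom.map_det]
  congr 3 <;> ext i j <;> simp [GLPair.entries]

/-- The coordinates of `(⋀^α₁ A ⊗ ⋀^α₂ B) T` for fixed `T`, as polynomials in the entries of `A` and
`B`. -/
def orbitPoly (T : BifocalIndex h₁ h₂ α₁ α₂ → ℂ) (st : BifocalIndex h₁ h₂ α₁ α₂) :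
    MvPolynomial ((Fin (h₁ + 1) × Fin (h₁ + 1)) ⊕ (Fin (h₂ + 1) × Fin (h₂ + 1))) ℂ :=
  MvPolynomial.eval (fun st' => MvPolynomial.C (T st')) (tensorActPoly st)

theorem eval_orbitPoly (T : BifocalIndex h₁ h₂ α₁ α₂ → ℂ) (st : BifocalIndex h₁ h₂ α₁ α₂)
    (g : GLPair (h₁ + 1) (h₂ + 1)) :
    MvPolynomial.eval g.entries (orbitPoly T st) = tensorAct g T st := by
  rw [← value_tensorActPoly, ActionPoly.value]
  change MvPolynomial.eval g.entries (MvPolynomial.eval₂ (RingHom.id _) _ _) = _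
  rw [MvPolynomial.hom_eval₂]
  simp

/-- The coordinates of `(⋀^α₁ A ⊗ ⋀^α₂ B) T` for fixed `A` and `B`, as linear forms in `T`. -/
def tensorActForm (g : GLPair (h₁ + 1) (h₂ + 1)) (st : BifocalIndex h₁ h₂ α₁ α₂) :
    MvPolynomial (BifocalIndex h₁ h₂ α₁ α₂) ℂ :=
  MvPolynomial.map (MvPolynomial.eval g.entries) (tensorActPoly st)

theorem isHomogeneous_tensorActForm (g : GLPair (h₁ + 1) (h₂ + 1))
    (st : BifocalIndex h₁ h₂ α₁ α₂) : (tensorActForm g st).IsHomogeneous 1 :=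
  (isHomogeneous_tensorActPoly st).map _

theorem eval_tensorActForm (g : GLPair (h₁ + 1) (h₂ + 1)) (v : BifocalIndex h₁ h₂ α₁ α₂ → ℂ)
    (st : BifocalIndex h₁ h₂ α₁ α₂) :
    MvPolynomial.eval v (tensorActForm g st) = tensorAct g v st := by
  rw [tensorActForm, MvPolynomial.eval_map, ← value_tensorActPoly]
  rfl

/-- The polynomial `det A * det B` in the entries of a pair of matrices. -/
def detPairPoly (m n : ℕ) : MvPolynomial ((Fin m × Fin m) ⊕ (Fin n × Fin n)) ℂ :=
  (Matrix.of fun i j => MvPolynomial.X (Sum.inl (i, j))).det *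
    (Matrix.of fun i j => MvPolynomial.X (Sum.inr (i, j))).det

theorem eval_detPairPoly {m n : ℕ} (e : (Fin m × Fin m) ⊕ (Fin n × Fin n) → ℂ) :
    MvPolynomial.eval e (detPairPoly m n) =
      (Matrix.of fun i j => e (Sum.inl (i, j))).det *
        (Matrix.of fun i j => e (Sum.inr (i, j))).det := by
  simp only [detPairPoly, map_mul, RingHom.map_det]
  congr 2 <;> ext i j <;> simp

theorem eval_detPairPoly_ne_zero_iff {m n : ℕ} (e : (Fin m × Fin m) ⊕ (Fin n × Fin n) → ℂ) :
    MvPolynomial.eval e (detPairPoly m n) ≠ 0 ↔ ∃ g : GLPair m n, g.entries = e := by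
  rw [eval_detPairPoly]
  constructor
  · intro h
    refine ⟨(Matrix.GeneralLinearGroup.mkOfDetNeZero _ (left_ne_zero_of_mul h),
      Matrix.GeneralLinearGroup.mkOfDetNeZero _ (right_ne_zero_of_mul h)), ?_⟩
    funext p
    rcases p with p | p <;> rfl
  · rintro ⟨g, rfl⟩
    exact mul_ne_zero (Matrix.GeneralLinearGroup.det_ne_zero g.1)
      (Matrix.GeneralLinearGroup.det_ne_zero g.2)

theorem detPairPoly_ne_zero (m n : ℕ) : detPairPoly m n ≠ 0 := by
  intro h
  have := (eval_detPairPoly_ne_zero_iff (1 : GLPair m n).entries).2 ⟨1, rfl⟩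
  rw [h, map_zero] at this
  exact this rfl

/-- Scaling the second matrix acts on tensors by the power `α₂` of the scalar, so that orbits are
cones. -/
theorem exists_smul_tensorAct_eq (hα₂ : 1 ≤ α₂) (g : GLPair (h₁ + 1) (h₂ + 1)) {t : ℂ}
    (ht : t ≠ 0) (T : BifocalIndex h₁ h₂ α₁ α₂ → ℂ) :
    ∃ g' : GLPair (h₁ + 1) (h₂ + 1), tensorAct g' T = t • tensorAct g T := by
  obtain ⟨s, hs⟩ := IsAlgClosed.exists_pow_nat_eq t hα₂
  have hs0 : s ≠ 0 := by
    rintro rfl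
    exact ht (by rw [← hs, zero_pow (by omega)])
  have hdet : (s • (g.2 : Matrix (Fin (h₂ + 1)) (Fin (h₂ + 1)) ℂ)).det ≠ 0 := by
    rw [Matrix.det_smul]
    exact mul_ne_zero (pow_ne_zero _ hs0) (Matrix.GeneralLinearGroup.det_ne_zero g.2)
  refine ⟨(g.1, Matrix.GeneralLinearGroup.mkOfDetNeZero _ hdet), ?_⟩
  funext st
  simp only [tensorAct, Pi.smul_apply, smul_eq_mul, Finset.mul_sum]
  refine Finset.sum_congr rfl fun st' _ => ?_
  have : (((Matrix.GeneralLinearGroup.mkOfDetNeZero _ hdet : GL (Fin (h₂ + 1)) ℂ) :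
      Matrix (Fin (h₂ + 1)) (Fin (h₂ + 1)) ℂ).submatrix st.2 st'.2).det =
      t * ((g.2 : Matrix (Fin (h₂ + 1)) (Fin (h₂ + 1)) ℂ).submatrix st.2 st'.2).det := by
    have hsmul := Matrix.det_smul
      ((g.2 : Matrix (Fin (h₂ + 1)) (Fin (h₂ + 1)) ℂ).submatrix st.2 st'.2) s
    rw [Fintype.card_fin, hs] at hsmul
    exact hsmul
  rw [this]
  ring

/-- The action of a pair of invertible matrices on the points of the projective space of tensors. -/
def ProjSpace.tensorAct (g : GLPair (h₁ + 1) (h₂ + 1))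
    (x : ProjSpace (BifocalIndex h₁ h₂ α₁ α₂)) : ProjSpace (BifocalIndex h₁ h₂ α₁ α₂) :=
  ProjSpace.mk (_root_.tensorAct g x.rep) (tensorAct_ne_zero g x.rep_ne_zero)

theorem ProjSpace.tensorAct_mk (g : GLPair (h₁ + 1) (h₂ + 1))
    {T : BifocalIndex h₁ h₂ α₁ α₂ → ℂ} (hT : T ≠ 0) :
    ProjSpace.tensorAct g (ProjSpace.mk T hT) =
      ProjSpace.mk (_root_.tensorAct g T) (tensorAct_ne_zero g hT) := by
  obtain ⟨c, -, hc⟩ := ProjSpace.exists_rep_mk T hT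
  exact ProjSpace.mk_smul _ _ (by rw [hc, tensorAct_smul])

end ActionPolynomials

/-! ### Orbits of tensors -/

section Orbit

variable {k h₁ h₂ α₁ α₂ : ℕ}

/-- The orbit of the point `[T]`. -/
def tensorOrbit (T : BifocalIndex h₁ h₂ α₁ α₂ → ℂ) : Set (ProjSpace (BifocalIndex h₁ h₂ α₁ α₂)) :=
  {x | ∃ (g : GLPair (h₁ + 1) (h₂ + 1)) (h : tensorAct g T ≠ 0), x = ProjSpace.mk (tensorAct g T) h}

theorem mk_tensorAct_mem_tensorOrbit {T : BifocalIndex h₁ h₂ α₁ α₂ → ℂ}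
    (g : GLPair (h₁ + 1) (h₂ + 1)) (h : tensorAct g T ≠ 0) :
    ProjSpace.mk (tensorAct g T) h ∈ tensorOrbit T := ⟨g, h, rfl⟩

theorem tensorAct_mem_tensorOrbit {T : BifocalIndex h₁ h₂ α₁ α₂ → ℂ}
    (g : GLPair (h₁ + 1) (h₂ + 1)) {x : ProjSpace (BifocalIndex h₁ h₂ α₁ α₂)}
    (hx : x ∈ tensorOrbit T) : ProjSpace.tensorAct g x ∈ tensorOrbit T := by
  obtain ⟨g', h, rfl⟩ := hx
  rw [ProjSpace.tensorAct_mk]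
  exact ⟨g * g', by rw [tensorAct_mul]; exact tensorAct_ne_zero g h, by
    congr 1; rw [tensorAct_mul]⟩

/-- The group acts on each orbit, by the action on projective space. -/
instance tensorOrbitAction (T : BifocalIndex h₁ h₂ α₁ α₂ → ℂ) :
    MulAction (GLPair (h₁ + 1) (h₂ + 1)) (tensorOrbit T) where
  smul g x := ⟨ProjSpace.tensorAct g x.1, tensorAct_mem_tensorOrbit g x.2⟩
  one_smul x := Subtype.ext <| by
    change ProjSpace.tensorAct 1 x.1 = x.1
    conv_rhs => rw [← x.1.mk_rep]
    unfold ProjSpace.tensorAct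
    congr 1
    exact tensorAct_one _
  mul_smul g g' x := Subtype.ext <| by
    change ProjSpace.tensorAct (g * g') x.1 = ProjSpace.tensorAct g (ProjSpace.tensorAct g' x.1)
    conv_rhs => rw [← x.1.mk_rep, ProjSpace.tensorAct_mk, ProjSpace.tensorAct_mk]
    unfold ProjSpace.tensorAct
    congr 1
    exact tensorAct_mul _ _ _

theorem coe_smul_tensorOrbit {T : BifocalIndex h₁ h₂ α₁ α₂ → ℂ} (g : GLPair (h₁ + 1) (h₂ + 1))
    (x : tensorOrbit T) : (g • x : tensorOrbit T).1 = ProjSpace.tensorAct g x.1 := rfl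

theorem isPretransitive_tensorOrbit {T : BifocalIndex h₁ h₂ α₁ α₂ → ℂ} :
    MulAction.IsPretransitive (GLPair (h₁ + 1) (h₂ + 1)) (tensorOrbit T) where
  exists_smul_eq := by
    rintro ⟨_, g, h, rfl⟩ ⟨_, g', h', rfl⟩
    refine ⟨g' * g⁻¹, Subtype.ext ?_⟩
    rw [coe_smul_tensorOrbit, ProjSpace.tensorAct_mk]
    congr 1
    rw [← tensorAct_mul, inv_mul_cancel_right]

theorem isRegularAction_tensorOrbit (T : BifocalIndex h₁ h₂ α₁ α₂ → ℂ) :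
    IsRegularAction (m := h₁ + 1) (n := h₂ + 1) (tensorOrbit T) := by
  intro g₀ y₀
  refine ⟨1, tensorActPoly, isHomogeneous_tensorActPoly, ?_, ?_⟩
  · simp only [value_tensorActPoly]
    exact tensorAct_ne_zero g₀ y₀.1.rep_ne_zero
  · intro g y h
    rw [coe_smul_tensorOrbit, ProjSpace.tensorAct]
    congr 1
    funext j
    rw [value_tensorActPoly]

/-- An orbit is irreducible since it is the image of `GL × GL`, a principal open subset of an affine
space. -/
theorem isIrreducible_tensorOrbit {T : BifocalIndex h₁ h₂ α₁ α₂ → ℂ} (hT : T ≠ 0) :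
    IsIrreducible (tensorOrbit T) := by
  refine ⟨⟨_, mk_tensorAct_mem_tensorOrbit 1 (tensorAct_ne_zero 1 hT)⟩,
    ProjSpace.isPreirreducible_iff.2 ?_⟩
  have key : ∀ (F : MvPolynomial (BifocalIndex h₁ h₂ α₁ α₂) ℂ) (g : GLPair (h₁ + 1) (h₂ + 1)),
      MvPolynomial.eval g.entries (MvPolynomial.aeval (orbitPoly T) F) =
        MvPolynomial.eval (tensorAct g T) F := fun F g => by
    rw [MvPolynomial.eval_aeval]
    simp only [eval_orbitPoly]
  have hne : ∀ (F : MvPolynomial (BifocalIndex h₁ h₂ α₁ α₂) ℂ) (d : ℕ), F.IsHomogeneous d →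
      (∃ x ∈ tensorOrbit T, MvPolynomial.eval x.rep F ≠ 0) →
        MvPolynomial.aeval (orbitPoly T) F ≠ 0 := by
    rintro F d hF ⟨_, ⟨g, h, rfl⟩, hx⟩ h0
    rw [ProjSpace.eval_rep_mk_ne_zero hF, ← key, h0, map_zero] at hx
    exact hx rfl
  intro F G d e hF hG hFx hGx
  obtain ⟨u, hu⟩ := MvPolynomial.exists_eval_ne_zero
    (mul_ne_zero (mul_ne_zero (hne F d hF hFx) (hne G e hG hGx))
      (detPairPoly_ne_zero (h₁ + 1) (h₂ + 1)))
  rw [map_mul, map_mul] at hu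
  obtain ⟨g, rfl⟩ := (eval_detPairPoly_ne_zero_iff u).1 (right_ne_zero_of_mul hu)
  have hu' := left_ne_zero_of_mul hu
  rw [key, key] at hu'
  refine ⟨_, mk_tensorAct_mem_tensorOrbit g (tensorAct_ne_zero g hT), ?_, ?_⟩
  · exact (ProjSpace.eval_rep_mk_ne_zero hF _ _).2 (left_ne_zero_of_mul hu')
  · exact (ProjSpace.eval_rep_mk_ne_zero hG _ _).2 (right_ne_zero_of_mul hu')

/-- An orbit is open in its closure: by Chevalley's theorem it contains a nonempty open subset of
its closure, and the translates of this subset cover the orbit. -/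
theorem exists_isOpen_tensorOrbit_eq (hα₂ : 1 ≤ α₂) (T : BifocalIndex h₁ h₂ α₁ α₂ → ℂ) :
    ∃ U : Set (ProjSpace (BifocalIndex h₁ h₂ α₁ α₂)), IsOpen U ∧
      tensorOrbit T = closure (tensorOrbit T) ∩ U := by
  obtain ⟨a, d, ha, ⟨_, ⟨g₀, rfl⟩, hg₀⟩, hsub⟩ :=
    MvPolynomial.exists_homogeneous_principalOpen_subset_cone (orbitPoly T)
      (detPairPoly_ne_zero (h₁ + 1) (h₂ + 1))
      (O := Set.range fun g : GLPair (h₁ + 1) (h₂ + 1) => tensorAct g T)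
      (fun v => by
        constructor
        · rintro ⟨g, rfl⟩
          refine ⟨g.entries, (eval_detPairPoly_ne_zero_iff _).2 ⟨g, rfl⟩, ?_⟩
          simp only [eval_orbitPoly]
        · rintro ⟨e, he, rfl⟩
          obtain ⟨g, rfl⟩ := (eval_detPairPoly_ne_zero_iff e).1 he
          exact ⟨g, by simp only [eval_orbitPoly]⟩)
      (by
        rintro _ ⟨g, rfl⟩ t ht
        exact exists_smul_tensorAct_eq hα₂ g ht T)
  -- The translate by `g` of the form `F`.
  let tr : GLPair (h₁ + 1) (h₂ + 1) → MvPolynomial (BifocalIndex h₁ h₂ α₁ α₂) ℂ →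
      MvPolynomial (BifocalIndex h₁ h₂ α₁ α₂) ℂ := fun g F =>
    MvPolynomial.aeval (tensorActForm g) F
  have htr : ∀ g F n, F.IsHomogeneous n → (tr g F).IsHomogeneous n := fun g F n hF => by
    have := hF.aeval (tensorActForm g) fun st => isHomogeneous_tensorActForm g st
    rwa [one_mul] at this
  have hev : ∀ g F v, MvPolynomial.eval v (tr g F) = MvPolynomial.eval (tensorAct g v) F :=
    fun g F v => by
      rw [MvPolynomial.eval_aeval]
      simp only [eval_tensorActForm]
  refine ⟨⋃ g, {x | MvPolynomial.eval x.rep (tr g a) ≠ 0},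
    isOpen_iUnion fun g => ProjSpace.isOpen_basicOpen (htr g a d ha), ?_⟩
  refine Set.Subset.antisymm (fun x hx => ⟨subset_closure hx, ?_⟩) ?_
  · obtain ⟨g, h, rfl⟩ := hx
    refine Set.mem_iUnion.2 ⟨g₀ * g⁻¹, ?_⟩
    refine (ProjSpace.eval_rep_mk_ne_zero (htr _ a d ha) _ _).2 ?_
    rwa [hev, ← tensorAct_mul, inv_mul_cancel_right]
  · rintro x ⟨hx, hxU⟩
    obtain ⟨g, hg⟩ := Set.mem_iUnion.1 hxU
    have hg' : MvPolynomial.eval (tensorAct g x.rep) a ≠ 0 := by rw [← hev]; exact hg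
    obtain ⟨g', hg'⟩ := hsub (tensorAct g x.rep) (fun F n hF hFO => by
      by_contra hne
      rw [← hev] at hne
      obtain ⟨_, ⟨g', h', rfl⟩, hy⟩ := ProjSpace.mem_closure_iff.1 hx _ n (htr g F n hF) hne
      rw [ProjSpace.eval_rep_mk_ne_zero (htr g F n hF), hev, ← tensorAct_mul] at hy
      exact hy (hFO _ ⟨_, rfl⟩)) hg'
    have hx' : x.rep = tensorAct (g⁻¹ * g') T := by
      rw [tensorAct_mul]
      change _ = tensorAct g⁻¹ ((fun g => tensorAct g T) g')
      rw [hg', ← tensorAct_mul, inv_mul_cancel, tensorAct_one]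
    exact ⟨g⁻¹ * g', hx' ▸ x.rep_ne_zero, x.mk_rep.symm.trans (by congr 1)⟩

/-- The orbit of a point, as a homogeneous space. -/
def tensorOrbitSpace (hα₂ : 1 ≤ α₂) {T : BifocalIndex h₁ h₂ α₁ α₂ → ℂ} (hT : T ≠ 0) :
    HomogeneousSpace (h₁ + 1) (h₂ + 1) where
  Index := BifocalIndex h₁ h₂ α₁ α₂
  finite_index := inferInstance
  carrier := tensorOrbit T
  isVariety := by
    refine ⟨?_, isIrreducible_tensorOrbit hT⟩
    obtain ⟨U, hU, h⟩ := exists_isOpen_tensorOrbit_eq hα₂ T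
    rw [h]
    exact isClosed_closure.isLocallyClosed.inter hU.isLocallyClosed
  action := tensorOrbitAction T
  transitive := isPretransitive_tensorOrbit
  regular := isRegularAction_tensorOrbit T

end Orbit

/-! ### The general bifocal tensor -/

section GeneralTensor

variable {k h₁ h₂ α₁ α₂ : ℕ}

/-- The pair of cameras with indeterminate entries. -/
def genericCameraPair (k h₁ h₂ : ℕ) : Matrix (Fin (h₁ + 1) ⊕ Fin (h₂ + 1)) (Fin (k + 1))
    (MvPolynomial ((Fin (h₁ + 1) ⊕ Fin (h₂ + 1)) × Fin (k + 1)) ℂ) :=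
  Matrix.of fun i j => MvPolynomial.X (i, j)

theorem eval_det_genericCameraPair (P : CameraPair k h₁ h₂)
    (r : Fin (k + 1) → Fin (h₁ + 1) ⊕ Fin (h₂ + 1)) :
    MvPolynomial.eval (fun p => P p.1 p.2) ((genericCameraPair k h₁ h₂).submatrix r id).det =
      pluckerCoord P r := by
  rw [RingHom.map_det, pluckerCoord]
  congr 1
  ext i j
  simp [genericCameraPair]

/-- Rows of the standard pair of cameras that form the identity matrix, among them all the rows of
the first block. -/
def rowsInl (k h₁ h₂ : ℕ) (hh₂ : h₂ ≤ k) (hk : k ≤ h₁ + h₂ + 1) (i : Fin (k + 1)) :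
    Fin (h₁ + 1) ⊕ Fin (h₂ + 1) :=
  if h : (i : ℕ) < h₁ + 1 then Sum.inl ⟨i, h⟩ else Sum.inr ⟨i - (k - h₂), by omega⟩

/-- Rows of the standard pair of cameras that form the identity matrix, among them all the rows of
the second block. -/
def rowsInr (k h₁ h₂ : ℕ) (hh₂ : h₂ ≤ k) (hk : k ≤ h₁ + h₂ + 1) (i : Fin (k + 1)) :
    Fin (h₁ + 1) ⊕ Fin (h₂ + 1) :=
  if h : k - h₂ ≤ (i : ℕ) then Sum.inr ⟨i - (k - h₂), by omega⟩ else Sum.inl ⟨i, by omega⟩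

theorem pluckerCoord_standardCameraPair_rowsInl (hh₂ : h₂ ≤ k) (hk : k ≤ h₁ + h₂ + 1) :
    pluckerCoord (standardCameraPair k h₁ h₂) (rowsInl k h₁ h₂ hh₂ hk) = 1 := by
  rw [pluckerCoord, ← Matrix.det_one (n := Fin (k + 1)) (R := ℂ)]
  congr 1
  ext i j
  by_cases h : (i : ℕ) < h₁ + 1
  · simp [rowsInl, h, standardCameraPair, Matrix.one_apply, Fin.ext_iff]
  · have h' : (i : ℕ) - (k - h₂) + (k - h₂) = i := by omega
    simp [rowsInl, h, standardCameraPair, Matrix.one_apply, Fin.ext_iff, h']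

theorem pluckerCoord_standardCameraPair_rowsInr (hh₂ : h₂ ≤ k) (hk : k ≤ h₁ + h₂ + 1) :
    pluckerCoord (standardCameraPair k h₁ h₂) (rowsInr k h₁ h₂ hh₂ hk) = 1 := by
  rw [pluckerCoord, ← Matrix.det_one (n := Fin (k + 1)) (R := ℂ)]
  congr 1
  ext i j
  by_cases h : k - h₂ ≤ (i : ℕ)
  · have h' : (i : ℕ) - (k - h₂) + (k - h₂) = i := by omega
    simp [rowsInr, h, standardCameraPair, Matrix.one_apply, Fin.ext_iff, h']
  · simp [rowsInr, h, standardCameraPair, Matrix.one_apply, Fin.ext_iff]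

theorem linearIndependent_rows_of_pluckerCoord_ne_zero {P : CameraPair k h₁ h₂}
    {r : Fin (k + 1) → Fin (h₁ + 1) ⊕ Fin (h₂ + 1)} (h : pluckerCoord P r ≠ 0) :
    LinearIndependent ℂ (P.row ∘ r) := by
  have hu : IsUnit (P.submatrix r id) := (Matrix.isUnit_iff_isUnit_det _).2 (isUnit_iff_ne_zero.2 h)
  exact Matrix.linearIndependent_rows_iff_isUnit.2 hu

theorem linearIndependent_cols_of_bifocalTensor_ne_zero (hα : α₁ + α₂ = k + 1)
    {P : CameraPair k h₁ h₂}
    (h : (bifocalTensor hα P : BifocalIndex h₁ h₂ α₁ α₂ → ℂ) ≠ 0) :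
    LinearIndependent ℂ P.col := by
  obtain ⟨st, hst⟩ := Function.ne_iff.1 h
  have hu : IsUnit (P.submatrix (bifocalRows hα st) id) :=
    (Matrix.isUnit_iff_isUnit_det _).2 (isUnit_iff_ne_zero.2 hst)
  exact LinearIndependent.of_comp (LinearMap.funLeft ℂ ℂ (bifocalRows hα st))
    (Matrix.linearIndependent_cols_iff_isUnit.2 hu)

theorem bifocalTensor_standardCameraPair_ne_zero (hh₂ : h₂ ≤ k) (hα : α₁ + α₂ = k + 1)
    (hα₁ : α₁ ≤ h₁ + 1) (hα₂ : α₂ ≤ h₂ + 1) :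
    (bifocalTensor hα (standardCameraPair k h₁ h₂) : BifocalIndex h₁ h₂ α₁ α₂ → ℂ) ≠ 0 := by
  -- The first `α₁` rows of the first block and the last `α₂` rows of the second one form the
  -- identity matrix.
  let s : Fin α₁ ↪o Fin (h₁ + 1) := Fin.castLEOrderEmb hα₁
  let t : Fin α₂ ↪o Fin (h₂ + 1) := OrderEmbedding.ofStrictMono
    (fun j => ⟨j + (h₂ + 1 - α₂), by omega⟩) fun i j hij => by
      have : (i : ℕ) < j := hij
      exact Fin.mk_lt_mk.2 (by omega)
  have ht : ∀ j, ((t j : Fin (h₂ + 1)) : ℕ) = j + (h₂ + 1 - α₂) := fun _ => rfl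
  refine Function.ne_iff.2 ⟨(s, t), ?_⟩
  have : bifocalTensor hα (standardCameraPair k h₁ h₂) (s, t) = 1 := by
    rw [bifocalTensor, pluckerCoord,
      ← Matrix.det_submatrix_equiv_self (finSumFinEquiv.trans (finCongr hα)),
      ← Matrix.det_one (n := Fin α₁ ⊕ Fin α₂) (R := ℂ)]
    congr 1
    ext i j
    have hv : ∀ i : Fin α₂, (i : ℕ) + (h₂ + 1 - α₂) + (k - h₂) = α₁ + i := fun i => by omega
    rcases i with i | i <;> rcases j with j | j
    · simp [bifocalRows, standardCameraPair, s, Matrix.one_apply, Fin.ext_iff]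
    · have := i.2
      have : (i : ℕ) ≠ α₁ + j := by omega
      simp [bifocalRows, standardCameraPair, s, this]
    · have := j.2
      have : α₁ + (i : ℕ) ≠ j := by omega
      simp [bifocalRows, standardCameraPair, ht, hv, this]
    · simp [bifocalRows, standardCameraPair, ht, hv, Matrix.one_apply, Fin.ext_iff]
  rw [this]
  exact one_ne_zero

theorem tensorOrbit_subset_bifocalTensorImage (hα : α₁ + α₂ = k + 1) (P : CameraPair k h₁ h₂) :
    tensorOrbit (bifocalTensor hα P) ⊆ bifocalTensorImage h₁ h₂ hα := by
  rintro _ ⟨g, h, rfl⟩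
  simp only [← bifocalTensor_fromBlocks_mul] at h ⊢
  refine ⟨_, ?_, _, rfl, h, rfl⟩
  rw [finrank_span_eq_card (linearIndependent_cols_of_bifocalTensor_ne_zero hα h), Fintype.card_fin]

/-- The general subspace of dimension `k + 1` is in the orbit of the standard one, so that the orbit
of the standard tensor is dense. -/
theorem bifocalTensorImage_subset_closure_tensorOrbit (hh₁ : h₁ ≤ k) (hh₂ : h₂ ≤ k)
    (hα : α₁ + α₂ = k + 1) (hα₁ : α₁ ≤ h₁ + 1) (hα₂ : α₂ ≤ h₂ + 1) :
    (bifocalTensorImage h₁ h₂ hα : Set (ProjSpace (BifocalIndex h₁ h₂ α₁ α₂))) ⊆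
      closure (tensorOrbit (bifocalTensor hα (standardCameraPair k h₁ h₂))) := by
  have hk : k ≤ h₁ + h₂ + 1 := by omega
  rintro _ ⟨-, -, P, -, hP, rfl⟩
  refine ProjSpace.mem_closure_iff.2 fun F d hF hFP => ?_
  rw [ProjSpace.eval_rep_mk_ne_zero hF] at hFP
  let τ : BifocalIndex h₁ h₂ α₁ α₂ →
      MvPolynomial ((Fin (h₁ + 1) ⊕ Fin (h₂ + 1)) × Fin (k + 1)) ℂ := fun st =>
    ((genericCameraPair k h₁ h₂).submatrix (bifocalRows hα st) id).det
  have hτ : ∀ P : CameraPair k h₁ h₂,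
      MvPolynomial.eval (fun p => P p.1 p.2) (MvPolynomial.aeval τ F) =
        MvPolynomial.eval (bifocalTensor hα P) F := fun P => by
    rw [MvPolynomial.eval_aeval]
    simp only [τ, eval_det_genericCameraPair]
    rfl
  have hF0 : MvPolynomial.aeval τ F ≠ 0 := fun h => hFP (by rw [← hτ, h, map_zero])
  have hne : ∀ r, pluckerCoord (standardCameraPair k h₁ h₂) r = 1 →
      ((genericCameraPair k h₁ h₂).submatrix r id).det ≠ 0 := fun r hr h => by
    rw [← eval_det_genericCameraPair, h, map_zero] at hr
    exact zero_ne_one hr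
  -- A pair of cameras at which `F` and two maximal minors do not vanish is in general position.
  obtain ⟨e, he⟩ := MvPolynomial.exists_eval_ne_zero (mul_ne_zero hF0 (mul_ne_zero
    (hne _ (pluckerCoord_standardCameraPair_rowsInl hh₂ hk))
    (hne _ (pluckerCoord_standardCameraPair_rowsInr hh₂ hk))))
  let P' : CameraPair k h₁ h₂ := Matrix.of fun i j => e (i, j)
  have heP : e = fun p => P' p.1 p.2 := rfl
  rw [map_mul, map_mul, heP, hτ, eval_det_genericCameraPair, eval_det_genericCameraPair] at he
  have hr₁ := linearIndependent_rows_of_pluckerCoord_ne_zero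
    (left_ne_zero_of_mul (right_ne_zero_of_mul he))
  have hr₂ := linearIndependent_rows_of_pluckerCoord_ne_zero
    (right_ne_zero_of_mul (right_ne_zero_of_mul he))
  have hFP' := left_ne_zero_of_mul he
  have hP₁ : LinearIndependent ℂ fun i => P' (Sum.inl i) := by
    have := hr₁.comp (fun i : Fin (h₁ + 1) => (⟨i, by omega⟩ : Fin (k + 1)))
      fun i j hij => Fin.ext (Fin.mk.inj_iff.1 hij)
    convert this using 2 with i
    have hi : rowsInl k h₁ h₂ hh₂ hk ⟨i, by omega⟩ = Sum.inl i := dif_pos i.2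
    exact (congrArg P' hi).symm
  have hP₂ : LinearIndependent ℂ fun i => P' (Sum.inr i) := by
    have := hr₂.comp (fun i : Fin (h₂ + 1) => (⟨i + (k - h₂), by omega⟩ : Fin (k + 1)))
      fun i j hij => by
        have : (i : ℕ) + (k - h₂) = j + (k - h₂) := Fin.mk.inj_iff.1 hij
        exact Fin.ext (by omega)
    convert this using 2 with i
    have hi : rowsInr k h₁ h₂ hh₂ hk ⟨i + (k - h₂), by omega⟩ = Sum.inr i := by simp [rowsInr]
    exact (congrArg P' hi).symm
  have hspan : Submodule.span ℂ (Set.range P'.row) = ⊤ := by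
    exact top_le_iff.1 ((hr₁.span_eq_top_of_card_eq_finrank (by simp)).symm.le.trans
      (Submodule.span_mono (Set.range_comp_subset_range _ _)))
  obtain ⟨g, Q, hgQ⟩ :=
    exists_eq_fromBlocks_mul_standardCameraPair_mul hh₁ hh₂ hk P' hP₁ hP₂ hspan
  rw [hgQ, bifocalTensor_fromBlocks_mul, bifocalTensor_mul_right, tensorAct_smul,
    hF.eval_smul] at hFP'
  refine ⟨_, mk_tensorAct_mem_tensorOrbit g (tensorAct_ne_zero g
    (bifocalTensor_standardCameraPair_ne_zero hh₂ hα hα₁ hα₂)), ?_⟩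
  exact (ProjSpace.eval_rep_mk_ne_zero hF _ _).2 (right_ne_zero_of_mul hFP')

theorem bifocalVariety_eq_closure_tensorOrbit (hh₁ : h₁ ≤ k) (hh₂ : h₂ ≤ k)
    (hα : α₁ + α₂ = k + 1) (hα₁ : α₁ ≤ h₁ + 1) (hα₂ : α₂ ≤ h₂ + 1) :
    (bifocalVariety h₁ h₂ hα : Set (ProjSpace (BifocalIndex h₁ h₂ α₁ α₂))) =
      closure (tensorOrbit (bifocalTensor hα (standardCameraPair k h₁ h₂))) :=
  Set.Subset.antisymm
    (closure_minimal (bifocalTensorImage_subset_closure_tensorOrbit hh₁ hh₂ hα hα₁ hα₂)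
      isClosed_closure)
    (closure_mono (tensorOrbit_subset_bifocalTensorImage hα _))

/-- The identity of the orbit of `[T]`, as a birational map from the closure of the orbit to the
orbit. -/
def orbitClosureBirationalMap (hα₂ : 1 ≤ α₂) {T : BifocalIndex h₁ h₂ α₁ α₂ → ℂ} (hT : T ≠ 0)
    {X : Set (ProjSpace (BifocalIndex h₁ h₂ α₁ α₂))} (hX : X = closure (tensorOrbit T)) :
    BirationalMap X (tensorOrbitSpace hα₂ hT).carrier where
  source := tensorOrbit T
  target := tensorOrbit T
  source_open := hX ▸ exists_isOpen_tensorOrbit_eq hα₂ T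
  target_open := ⟨Set.univ, isOpen_univ, (Set.inter_univ _).symm⟩
  source_dense := hX.le
  target_dense := subset_closure
  toFun := id
  invFun := id
  mapsTo := Set.mapsTo_id _
  mapsTo_inv := Set.mapsTo_id _
  invOn := ⟨fun _ _ => rfl, fun _ _ => rfl⟩
  regular := ProjSpace.isRegularMapOn_id _
  regular_inv := ProjSpace.isRegularMapOn_id _

theorem isEquivariant_orbitClosureBirationalMap (hα₂ : 1 ≤ α₂)
    {T : BifocalIndex h₁ h₂ α₁ α₂ → ℂ} (hT : T ≠ 0)
    {X : Set (ProjSpace (BifocalIndex h₁ h₂ α₁ α₂))} (hX : X = closure (tensorOrbit T)) :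
    (orbitClosureBirationalMap hα₂ hT hX).IsEquivariant := by
  intro g S hS hx
  refine ⟨tensorAct_ne_zero g hS, ?_, Subtype.ext ?_⟩
  · rw [← ProjSpace.tensorAct_mk g hS]
    exact tensorAct_mem_tensorOrbit g hx
  · exact (ProjSpace.tensorAct_mk g hS).symm

end GeneralTensor

end

theorem mainTheorem12 (k h₁ h₂ α₁ α₂ : ℕ) (hh₁ : h₁ < k) (hh₂ : h₂ < k)
    (hα₁_pos : 1 ≤ α₁) (hα₂_pos : 1 ≤ α₂) (hα₁ : α₁ ≤ h₁ + 1) (hα₂ : α₂ ≤ h₂ + 1)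
    (hα : α₁ + α₂ = k + 1) :
    IsQuasiProjectiveVariety (bifocalVariety h₁ h₂ hα) ∧
      ∃ (Y : HomogeneousSpace (h₁ + 1) (h₂ + 1))
        (φ : BirationalMap (bifocalVariety h₁ h₂ hα) Y.carrier), φ.IsEquivariant := by
  have hT := bifocalTensor_standardCameraPair_ne_zero hh₂.le hα hα₁ hα₂
  have hX := bifocalVariety_eq_closure_tensorOrbit hh₁.le hh₂.le hα hα₁ hα₂
  refine ⟨?_, tensorOrbitSpace hα₂_pos hT, orbitClosureBirationalMap hα₂_pos hT hX,
    isEquivariant_orbitClosureBirationalMap hα₂_pos hT hX⟩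
  rw [hX]
  exact ⟨isClosed_closure.isLocallyClosed, (isIrreducible_tensorOrbit hT).closure⟩
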